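/- For a graph $G$ with a perfect matching $M$, a forcing set of $M$ is a subset of $M$ that is contained in no other perfect matching of $G$; the forcing number $f(G,M)$ is the smallest cardinality of a forcing set of $M$. The forcing polynomial of a finite graph $G$ is $F(G,x)=\sum_{M}x^{f(G,M)}$, summed over all perfect matchings $M$ of $G$; the empty graph has the empty perfect matching, with forcing number $0$. In the tiling of the plane by regular hexagons with vertical sides, fix a hexagon $C_{1,1}$ and let $C_{i,j}$ ($i,j\ge 1$) be the hexagon obtained from $C_{1,1}$ by $j-1$ steps to the left neighbour and $i-1$ steps to the lower-left neighbour. For integers $m\ge 0$ and $k_1,\dots,k_m\ge 0$, let $CHS(\{k_s;1\}_{s=1}^{m})$ be the graph formed by the vertices and edges of all hexagons $C_{i,j}$ with $1\le i\le m$ and $1\le j\le k_i$ (so a row with $k_i=0$ contributes no hexagon, and the graph is empty if $m=0$), and write $F(\{k_s;1\}_{s=1}^{m})=F(CHS(\{k_s;1\}_{s=1}^{m}),x)$. When $m\ge 1$ and $1\le k_1\le k_2\le\cdots\le k_m$, this graph is called a truncated parallelogram. **Corollary.** For all integers $m\ge 1$ and $1\le k_1\le k_2\le\cdots\le k_m$,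 $$F(\{k_s;1\}_{s=1}^{m})=\sum_{i=0}^{k_m-1}F(\{\min\{k_s,i\};1\}_{s=1}^{m-1})\,x+\sum_{j=\min\{s:\,k_s=k_m\}}^{m}F(\{\min\{k_s,k_m-1\};1\}_{s=1}^{j-1})\,x ,$$ where $F(\{b_s;1\}_{s=1}^{i})=F(\{b_s;1\}_{s=1}^{i-1})$ if $b_i=0$ and $i\ge 1$, and $F(\{b_s;1\}_{s=1}^{j})=1$ if $j=0$. -/

import Mathlib

open Polynomial

noncomputable section

namespace Forcing

/-- `S` is a forcing set of the perfect matching `M` of `G`: a subset of `M` that is contained in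
no other perfect matching of `G`. -/
def IsForcingSet {V : Type*} {G : SimpleGraph V} (M : G.Subgraph) (S : Finset (Sym2 V)) : Prop :=
  (S : Set (Sym2 V)) ⊆ M.edgeSet ∧
    ∀ M' : G.Subgraph, M'.IsPerfectMatching → (S : Set (Sym2 V)) ⊆ M'.edgeSet → M' = M

/-- The forcing number `f(G, M)`: the smallest cardinality of a forcing set of `M`. -/
def forcingNumber {V : Type*} {G : SimpleGraph V} (M : G.Subgraph) : ℕ :=
  sInf {n | ∃ S : Finset (Sym2 V), IsForcingSet M S ∧ S.card = n}

/-- The forcing polynomial `F(G, x) = ∑ x ^ f(G, M)`, summed over all perfect matchings `M`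
of the finite graph `G`. -/
def forcingPolynomial {V : Type*} [Finite V] (G : SimpleGraph V) : ℕ[X] :=
  ∑ M ∈ (Set.toFinite {M : G.Subgraph | M.IsPerfectMatching}).toFinset, X ^ forcingNumber M

/-- Vertices of the infinite hexagonal lattice in which some edges are vertical. Every vertex is
an end of exactly one vertical edge, and `upper i j`, `lower i j` are the upper and the lower end
of the left vertical edge of the hexagon `C_{i,j}`.

Here the centre of `C_{i,j}` is the point `(-(j-1) - (i-1)/2, -(√3/2)(i-1))` of the plane: going
from `j` to `j + 1` is a unit step to the left, and going from `i` to `i + 1` is a unit step to the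
lower left. So `upper i j` and `lower i j` are this centre plus `(-1/2, √3/6)`, respectively plus
`(-1/2, -√3/6)`. -/
inductive HexVertex : Type
  | upper (i j : ℤ) : HexVertex
  | lower (i j : ℤ) : HexVertex

/-- The six corners of the hexagon `C_{i,j}`, in counterclockwise order: top, upper left,
lower left, bottom, lower right, upper right. -/
def corner (c : ℤ × ℤ) : Fin 6 → HexVertex :=
  ![.lower (c.1 - 1) c.2, .upper c.1 c.2, .lower c.1 c.2,
    .upper (c.1 + 1) (c.2 - 1), .lower c.1 (c.2 - 1), .upper c.1 (c.2 - 1)]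

/-- The corners of the hexagons in `S`. -/
def hexVertices (S : Finset (ℤ × ℤ)) : Set HexVertex :=
  {v | ∃ c ∈ S, ∃ t : Fin 6, v = corner c t}

/-- The sides of the hexagons in `S` (`t + 1` is taken modulo 6). -/
def hexEdges (S : Finset (ℤ × ℤ)) : Set (Sym2 HexVertex) :=
  {e | ∃ c ∈ S, ∃ t : Fin 6, e = s(corner c t, corner c (t + 1))}

instance finite_hexVertices (S : Finset (ℤ × ℤ)) : Finite (hexVertices S) := by
  have h : hexVertices S = ⋃ c ∈ S, Set.range (corner c) := by
    ext v
    simp [hexVertices, eq_comm]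
  rw [h]
  exact (S.finite_toSet.biUnion fun c _ => Set.finite_range (corner c)).to_subtype

/-- The graph formed by the corners and sides of the hexagons in `S`. -/
def hexGraph (S : Finset (ℤ × ℤ)) : SimpleGraph (hexVertices S) :=
  (SimpleGraph.fromEdgeSet (hexEdges S)).induce (hexVertices S)

/-- The hexagons `C_{i,j}` with `1 ≤ i ≤ m` and `h_i ≤ j ≤ k_i`. A row with `k_i < h_i`
contributes no hexagon. -/
def chsCells (k h : ℕ → ℕ) (m : ℕ) : Finset (ℤ × ℤ) :=
  (Finset.Icc 1 m).biUnion fun i =>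
    (Finset.Icc (h i) (k i)).image fun j : ℕ => ((i : ℤ), (j : ℤ))

/-- The constructable hexagonal system `CHS(k_1, …, k_m; h_1, …, h_m)` with `m` rows, whose `i`-th
row consists of the hexagons `C_{i,k_i}, …, C_{i,h_i}` from left to right. Only the values of `k`
and `h` at `1, …, m` matter. -/
def CHS (k h : ℕ → ℕ) (m : ℕ) : SimpleGraph (hexVertices (chsCells k h m)) :=
  hexGraph (chsCells k h m)

/-- The forcing polynomial `F({k_s; 1}_{s=1}^m)` of `CHS(k_1, …, k_m; 1, …, 1)`. -/
def F (k : ℕ → ℕ) (m : ℕ) : ℕ[X] :=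
  forcingPolynomial (CHS k (fun _ => 1) m)

end Forcing

end

/-!
Let the rows of the truncated parallelogram have lengths `k 1 ≤ ⋯ ≤ k m`. A perfect matching
contains exactly one vertical edge in each row, say at position `p i` in row `i`, and it is
determined by these positions, because the zigzags between consecutive rows are paths. The sequences
that occur are those with `p 1 ≤ ⋯ ≤ p m` and `p i ≤ k i` (`exists_of_zigzag`,
`setOf_isMatchingSet`); this is how the matchings are encoded (`pathFamily`).

The matchings are sorted by an edge `e` which they contain. If `p m = i < k m`, take the vertical
edge at position `i` in row `m`. If `p m = k m`, let `j` be the first row with `p j = k m` and take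
the edge from `lower (j - 1) (k m)` to `upper j (k m - 1)`, the upper right side of the hexagon
`C_{j, k m}`, which a matching contains if and only if `p (j - 1) < k m ≤ p j`. So each matching
contains exactly one of the edges that index the two sums of the recursion. Prescribing such an edge
`e` fixes the last rows and leaves, as freedom, a perfect matching of the smaller system with rows
`1, …, n` of lengths `min (k s) c`, where `(n, c)` is `(m - 1, i)` or `(j - 1, k m - 1)`.

Passing to the smaller system lowers the forcing number by exactly one
(`familyForcingNumber_eq_succ`): `e` together with a forcing set of the smaller matching is a
forcing set; conversely, the part of a forcing set in the smaller system forces the smaller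
matching, and a forcing set needs one more edge since there is an alternating hexagon disjoint from
the smaller system, namely the one whose rotation changes `p (n + 1)` by one. No min-max theorem for
forcing numbers of planar bipartite graphs is needed.

Forcing sets and forcing numbers make sense for the members of any family of sets, and injective
maps preserve them (`familyPolynomial_image`). This moves the problem from subgraphs to sets of
`LatticeEdge`s, where only inequalities between natural numbers remain.
-/

noncomputable section

namespace Forcing

/-! ### Forcing in families of sets -/

/-- `S` is a forcing set of the member `E` of the family `𝓔`: a finite subset of `E` that is
contained in no other member of `𝓔`. -/
def IsFamilyForcingSet {α : Type*} (𝓔 : Set (Set α)) (E : Set α) (S : Finset α) : Prop :=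
  (S : Set α) ⊆ E ∧ ∀ E' ∈ 𝓔, (S : Set α) ⊆ E' → E' = E

/-- The smallest cardinality of a forcing set of `E` in the family `𝓔`; it is `0` if `E` has no
(finite) forcing set. -/
def familyForcingNumber {α : Type*} (𝓔 : Set (Set α)) (E : Set α) : ℕ :=
  sInf {n | ∃ S : Finset α, IsFamilyForcingSet 𝓔 E S ∧ S.card = n}

/-- The forcing polynomial of a family of sets. As a `finsum`, it is `0` for infinite families. -/
def familyPolynomial {α : Type*} (𝓔 : Set (Set α)) : ℕ[X] :=
  ∑ᶠ E ∈ 𝓔, X ^ familyForcingNumber 𝓔 E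

lemma familyForcingNumber_image {α β : Type*} {f : α → β} (hf : f.Injective)
    (𝓔 : Set (Set α)) (E : Set α) :
    familyForcingNumber (Set.image f '' 𝓔) (f '' E) = familyForcingNumber 𝓔 E := by
  classical
  unfold familyForcingNumber
  congr 1
  ext n
  constructor
  · rintro ⟨S, ⟨hS, hS'⟩, rfl⟩
    obtain ⟨S, hSE, rfl⟩ := Finset.subset_set_image_iff.1 hS
    refine ⟨S, ⟨hSE, fun E' hE' h => ?_⟩, (Finset.card_image_of_injective S hf).symm⟩
    have := hS' _ (Set.mem_image_of_mem _ hE') (by rw [Finset.coe_image]; exact Set.image_mono h)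
    exact hf.image_injective this
  · rintro ⟨S, ⟨hS, hS'⟩, rfl⟩
    refine ⟨S.image f, ⟨?_, ?_⟩, Finset.card_image_of_injective S hf⟩
    · rw [Finset.coe_image]; exact Set.image_mono hS
    · rintro _ ⟨E', hE', rfl⟩ h
      rw [Finset.coe_image, Set.image_subset_image_iff hf] at h
      rw [hS' E' hE' h]

lemma familyPolynomial_image {α β : Type*} {f : α → β} (hf : f.Injective) (𝓔 : Set (Set α)) :
    familyPolynomial (Set.image f '' 𝓔) = familyPolynomial 𝓔 := by
  unfold familyPolynomial
  rw [finsum_mem_image hf.image_injective.injOn]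
  simp only [familyForcingNumber_image hf]

lemma familyPolynomial_singleton {α : Type*} (E : Set α) : familyPolynomial {E} = 1 := by
  have h : familyForcingNumber {E} E = 0 := by
    refine Nat.sInf_eq_zero.2 (Or.inl ⟨∅, ⟨by simp, ?_⟩, by simp⟩)
    rintro E' rfl -
    rfl
  rw [familyPolynomial, finsum_mem_singleton, h, pow_zero]

/-- If the members of `𝓔` that contain `e` all agree outside of a set `R` of which `e` is not an
element, and their traces on `R` form the family `𝓗`, and each of them can be changed without
losing its trace on `R`, then passing to the trace lowers the forcing number by exactly one:
`e` together with a forcing set of the trace is a forcing set, and conversely a forcing set needs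
an element outside of `R`, while its part in `R` forces the trace. -/
lemma familyForcingNumber_eq_succ {α : Type*} {𝓔 𝓗 : Set (Set α)} {R : Set α} {e : α}
    (heR : e ∉ R)
    (htrace : ∀ E ∈ 𝓔, e ∈ E → E ∩ R ∈ 𝓗)
    (hext : ∀ H ∈ 𝓗, ∃ E ∈ 𝓔, e ∈ E ∧ E ∩ R = H)
    (hout : ∀ E ∈ 𝓔, e ∈ E → ∀ E' ∈ 𝓔, e ∈ E' → E \ R ⊆ E')
    (hflip : ∀ E ∈ 𝓔, e ∈ E → ∃ E' ∈ 𝓔, E' ≠ E ∧ E ∩ R ⊆ E')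
    (hforce : ∀ H ∈ 𝓗, ∃ S, IsFamilyForcingSet 𝓗 H S)
    {E : Set α} (hE : E ∈ 𝓔) (he : e ∈ E) :
    familyForcingNumber 𝓔 E = familyForcingNumber 𝓗 (E ∩ R) + 1 := by
  classical
  obtain ⟨S, ⟨hS1, hS2⟩, hScard⟩ : familyForcingNumber 𝓗 (E ∩ R) ∈
      {n | ∃ S : Finset α, IsFamilyForcingSet 𝓗 (E ∩ R) S ∧ S.card = n} := by
    obtain ⟨S, hS⟩ := hforce _ (htrace E hE he)
    exact Nat.sInf_mem ⟨_, S, hS, rfl⟩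
  have hmem : familyForcingNumber 𝓗 (E ∩ R) + 1 ∈
      {n | ∃ S : Finset α, IsFamilyForcingSet 𝓔 E S ∧ S.card = n} := by
    refine ⟨insert e S, ⟨?_, fun E' hE' h => ?_⟩, ?_⟩
    · rw [Finset.coe_insert]
      exact Set.insert_subset he fun x hx => (hS1 hx).1
    · rw [Finset.coe_insert, Set.insert_subset_iff] at h
      have h1 : E' ∩ R = E ∩ R :=
        hS2 _ (htrace E' hE' h.1) fun x hx => ⟨h.2 hx, (hS1 hx).2⟩
      refine Set.Subset.antisymm (fun x hx => ?_) (fun x hx => ?_)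
      · by_cases hxR : x ∈ R
        · exact (h1.subset ⟨hx, hxR⟩).1
        · exact hout E' hE' h.1 E hE he ⟨hx, hxR⟩
      · by_cases hxR : x ∈ R
        · exact (h1.superset ⟨hx, hxR⟩).1
        · exact hout E hE he E' hE' h.1 ⟨hx, hxR⟩
    · rw [Finset.card_insert_of_notMem fun h => heR (hS1 h).2, hScard]
  refine le_antisymm (Nat.sInf_le hmem) ?_
  obtain ⟨T, ⟨hT1, hT2⟩, hTcard⟩ := Nat.sInf_mem ⟨_, hmem⟩
  change _ = familyForcingNumber 𝓔 E at hTcard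
  rw [← hTcard]
  have hle : familyForcingNumber 𝓗 (E ∩ R) ≤ (T.filter (· ∈ R)).card := by
    refine Nat.sInf_le ⟨_, ⟨fun x hx => ?_, fun H hH hsub => ?_⟩, rfl⟩
    · simp only [Finset.coe_filter, Set.mem_ofPred_eq] at hx
      exact ⟨hT1 hx.1, hx.2⟩
    · obtain ⟨E', hE', he', rfl⟩ := hext H hH
      rw [hT2 E' hE' fun x hx => ?_]
      by_cases hxR : x ∈ R
      · exact (hsub (by simpa using ⟨hx, hxR⟩)).1
      · exact hout E hE he E' hE' he' ⟨hT1 hx, hxR⟩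
  obtain ⟨E', hE', hne, hsub⟩ := hflip E hE he
  obtain ⟨x, hxT, hxR⟩ : ∃ x ∈ T, x ∉ R := by
    by_contra! h
    exact hne (hT2 E' hE' fun x hx => hsub ⟨hT1 hx, h x hx⟩)
  have hlt : (T.filter (· ∈ R)).card < T.card :=
    Finset.card_lt_card (Finset.filter_ssubset.2 ⟨x, hxT, hxR⟩)
  omega

lemma finsum_mem_familyForcingNumber {α : Type*} {𝓔 𝓗 : Set (Set α)} {R : Set α} {e : α}
    (heR : e ∉ R)
    (htrace : ∀ E ∈ 𝓔, e ∈ E → E ∩ R ∈ 𝓗)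
    (hext : ∀ H ∈ 𝓗, ∃ E ∈ 𝓔, e ∈ E ∧ E ∩ R = H)
    (hout : ∀ E ∈ 𝓔, e ∈ E → ∀ E' ∈ 𝓔, e ∈ E' → E \ R ⊆ E')
    (hflip : ∀ E ∈ 𝓔, e ∈ E → ∃ E' ∈ 𝓔, E' ≠ E ∧ E ∩ R ⊆ E')
    (hforce : ∀ H ∈ 𝓗, ∃ S, IsFamilyForcingSet 𝓗 H S) :
    ∑ᶠ E ∈ {E ∈ 𝓔 | e ∈ E}, (X : ℕ[X]) ^ familyForcingNumber 𝓔 E = familyPolynomial 𝓗 * X := by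
  have himage : 𝓗 = (· ∩ R) '' {E ∈ 𝓔 | e ∈ E} := by
    ext H
    constructor
    · intro hH
      obtain ⟨E, hE, he, h⟩ := hext H hH
      exact ⟨E, ⟨hE, he⟩, h⟩
    · rintro ⟨E, ⟨hE, he⟩, rfl⟩
      exact htrace E hE he
  have hinj : Set.InjOn (· ∩ R) {E ∈ 𝓔 | e ∈ E} := by
    rintro E ⟨hE, he⟩ E' ⟨hE', he'⟩ h
    change E ∩ R = E' ∩ R at h
    ext x
    by_cases hxR : x ∈ R
    · exact ⟨fun hx => (h.subset ⟨hx, hxR⟩).1, fun hx => (h.superset ⟨hx, hxR⟩).1⟩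
    · exact ⟨fun hx => hout E hE he E' hE' he' ⟨hx, hxR⟩,
        fun hx => hout E' hE' he' E hE he ⟨hx, hxR⟩⟩
  rw [familyPolynomial]
  conv_rhs => enter [1, 1, H]; rw [himage]
  rw [finsum_mem_image hinj, ← himage]
  refine Eq.trans ?_ (finsum_mem_mul _ _).symm
  refine finsum_mem_congr rfl fun E hE => ?_
  rw [familyForcingNumber_eq_succ heR htrace hext hout hflip hforce hE.1 hE.2, pow_succ]

/-! ### Lattice paths and their forcing polynomials -/

/-- Names for the edges of the hexagonal lattice: `vert i j` joins `upper i j` to `lower i j`, while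
`downLeft i j` and `downRight i j` are the other two edges at `lower i j`, leading to
`upper (i + 1) j` and to `upper (i + 1) (j - 1)`. -/
inductive LatticeEdge : Type
  | vert (i j : ℕ) : LatticeEdge
  | downLeft (i j : ℕ) : LatticeEdge
  | downRight (i j : ℕ) : LatticeEdge

/-- Weakly increasing sequences `p 1 ≤ ⋯ ≤ p m` with `p s ≤ k s`, where `p i` is the position of the
vertical edge in row `i` of a perfect matching. The fixed values `p 0 = 0` and `p (m + 1) = k m` let
the zigzags above the first row and below the last row be treated like those between two rows. -/
structure IsPath (k : ℕ → ℕ) (m : ℕ) (p : ℕ → ℕ) : Prop where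
  zero : p 0 = 0
  last : p (m + 1) = k m
  step : ∀ s ≤ m, p s ≤ p (s + 1)
  le : ∀ s ≤ m + 1, p s ≤ k s

/-- The perfect matching encoded by the path `p`. The edges at `lower i j` lie in the zigzag between
rows `i` and `i + 1`, which has room for `j ≤ k (i + 1)`. -/
def pathEdges (k : ℕ → ℕ) (m : ℕ) (p : ℕ → ℕ) : Set LatticeEdge :=
  {a | match a with
    | .vert i j => 1 ≤ i ∧ i ≤ m ∧ j = p i
    | .downLeft i j => i ≤ m ∧ j ≤ k (i + 1) ∧ (j < p i ∨ p (i + 1) < j)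
    | .downRight i j => i ≤ m ∧ p i < j ∧ j ≤ p (i + 1)}

/-- The family of the perfect matchings encoded by paths. -/
def pathFamily (k : ℕ → ℕ) (m : ℕ) : Set (Set LatticeEdge) :=
  {E | ∃ p, IsPath k m p ∧ E = pathEdges k m p}

section Membership

variable {k p : ℕ → ℕ} {m i j : ℕ}

lemma vert_mem_pathEdges :
    LatticeEdge.vert i j ∈ pathEdges k m p ↔ 1 ≤ i ∧ i ≤ m ∧ j = p i := Iff.rfl

lemma downLeft_mem_pathEdges :
    LatticeEdge.downLeft i j ∈ pathEdges k m p ↔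
      i ≤ m ∧ j ≤ k (i + 1) ∧ (j < p i ∨ p (i + 1) < j) := Iff.rfl

lemma downRight_mem_pathEdges :
    LatticeEdge.downRight i j ∈ pathEdges k m p ↔ i ≤ m ∧ p i < j ∧ j ≤ p (i + 1) := Iff.rfl

end Membership

lemma IsPath.mono {k p : ℕ → ℕ} {m : ℕ} (hp : IsPath k m p) {s t : ℕ} (hst : s ≤ t)
    (ht : t ≤ m + 1) : p s ≤ p t := by
  induction t, hst using Nat.le_induction with
  | base => exact le_rfl
  | succ t hst ih => exact (ih (by omega)).trans (hp.step t (by omega))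

lemma pathEdges_congr {k p q : ℕ → ℕ} {m : ℕ} (h : ∀ s ≤ m + 1, p s = q s) :
    pathEdges k m p = pathEdges k m q := by
  ext (⟨i, j⟩ | ⟨i, j⟩ | ⟨i, j⟩)
  · simp only [vert_mem_pathEdges]
    refine and_congr_right fun _ => and_congr_right fun hi => ?_
    rw [h i (by omega)]
  · simp only [downLeft_mem_pathEdges]
    refine and_congr_right fun hi => ?_
    rw [h i (by omega), h (i + 1) (by omega)]
  · simp only [downRight_mem_pathEdges]
    refine and_congr_right fun hi => ?_
    rw [h i (by omega), h (i + 1) (by omega)]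

lemma IsPath.eq_of_eq_rows {k p q : ℕ → ℕ} {m : ℕ} (hp : IsPath k m p) (hq : IsPath k m q)
    (h : ∀ s, 1 ≤ s → s ≤ m → p s = q s) {s : ℕ} (hs : s ≤ m + 1) : p s = q s := by
  rcases Nat.eq_zero_or_pos s with rfl | hs0
  · rw [hp.zero, hq.zero]
  · rcases hs.lt_or_eq with hlt | rfl
    · exact h s hs0 (by omega)
    · rw [hp.last, hq.last]

lemma exists_isFamilyForcingSet {k : ℕ → ℕ} {m : ℕ} {E : Set LatticeEdge}
    (hE : E ∈ pathFamily k m) : ∃ S, IsFamilyForcingSet (pathFamily k m) E S := by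
  classical
  obtain ⟨p, hp, rfl⟩ := hE
  refine ⟨(Finset.Icc 1 m).image fun s => .vert s (p s), ?_, ?_⟩
  · intro a ha
    obtain ⟨s, hs, rfl⟩ := by simpa using ha
    exact ⟨hs.1, hs.2, rfl⟩
  · rintro _ ⟨q, hq, rfl⟩ hsub
    refine pathEdges_congr fun s hs => (IsPath.eq_of_eq_rows hp hq (fun s h1 h2 => ?_) hs).symm
    have : LatticeEdge.vert s (p s) ∈ pathEdges k m q := hsub (by simpa using ⟨h1, h2⟩)
    exact (vert_mem_pathEdges.1 this).2.2

/-- The row lengths `k 1, …, k n`, cut down to at most `c` and continued by a constant. -/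
def truncate (k : ℕ → ℕ) (n c : ℕ) (s : ℕ) : ℕ := min (k (min s n)) c

/-- A region that contains the edges of the hexagonal system with row lengths
`truncate k n c 1, …, truncate k n c n`. The position of vertical edges is left free: the paths `p`
to which the region is applied satisfy `p i ≤ p n ≤ c` for `i ≤ n`. -/
def truncatedRegion (k : ℕ → ℕ) (n c : ℕ) : Set LatticeEdge :=
  {a | match a with
    | .vert i _ => i ≤ n
    | .downLeft i j => i ≤ n ∧ j ≤ truncate k n c (i + 1)
    | .downRight i j => i ≤ n ∧ j ≤ truncate k n c (i + 1)}

lemma truncate_of_le {k : ℕ → ℕ} {n c s : ℕ} (h : s ≤ n) : truncate k n c s = min (k s) c := by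
  rw [truncate, min_eq_left h]

lemma truncate_of_ge {k : ℕ → ℕ} {n c s : ℕ} (h : n ≤ s) : truncate k n c s = min (k n) c := by
  rw [truncate, min_eq_right h]

/-- The part of a matching in the truncated region is a perfect matching of that region as soon as
the path crosses the height `c` between the rows `n` and `n + 1`. -/
lemma pathEdges_inter_truncatedRegion {k p q : ℕ → ℕ} {m n c : ℕ} (hk : Monotone k)
    (hp : IsPath k m p) (hn : n < m) (hpn : p n ≤ c) (hc : c ≤ p (n + 1))
    (hq : ∀ s ≤ n, q s = p s) (hqn : q (n + 1) = min (k n) c) :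
    pathEdges k m p ∩ truncatedRegion k n c = pathEdges (truncate k n c) n q := by
  ext (⟨i, j⟩ | ⟨i, j⟩ | ⟨i, j⟩)
  · change (1 ≤ i ∧ i ≤ m ∧ j = p i) ∧ i ≤ n ↔ 1 ≤ i ∧ i ≤ n ∧ j = q i
    constructor
    · rintro ⟨⟨h1, h2, h3⟩, h4⟩
      exact ⟨h1, h4, h3.trans (hq i h4).symm⟩
    · rintro ⟨h1, h2, h3⟩
      exact ⟨⟨h1, by omega, h3.trans (hq i h2)⟩, h2⟩
  · change (i ≤ m ∧ j ≤ k (i + 1) ∧ (j < p i ∨ p (i + 1) < j)) ∧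
      (i ≤ n ∧ j ≤ truncate k n c (i + 1)) ↔
        i ≤ n ∧ j ≤ truncate k n c (i + 1) ∧ (j < q i ∨ q (i + 1) < j)
    rcases lt_trichotomy i n with h | rfl | h
    · rw [truncate_of_le (show i + 1 ≤ n from h), hq i h.le, hq (i + 1) h]
      omega
    · rw [truncate_of_ge (Nat.le_succ i), hq i le_rfl, hqn]
      have := hk (Nat.le_succ i)
      have := hp.le i (by omega)
      simp only [Nat.succ_eq_add_one] at *
      omega
    · omega
  · change (i ≤ m ∧ p i < j ∧ j ≤ p (i + 1)) ∧ (i ≤ n ∧ j ≤ truncate k n c (i + 1)) ↔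
        i ≤ n ∧ q i < j ∧ j ≤ q (i + 1)
    rcases lt_trichotomy i n with h | rfl | h
    · rw [truncate_of_le (show i + 1 ≤ n from h), hq i h.le, hq (i + 1) h]
      have := hp.mono (show i + 1 ≤ n from h) (by omega)
      have := hp.le (i + 1) (by omega)
      omega
    · rw [truncate_of_ge (Nat.le_succ i), hq i le_rfl, hqn]
      omega
    · omega

/-- Outside of the truncated region, a matching whose path stays below `c` up to row `n` depends
only on the rows after `n`. -/
lemma pathEdges_diff_truncatedRegion_subset {k p q : ℕ → ℕ} {m n c : ℕ}
    (hp : IsPath k m p) (hq : IsPath k m q) (hn : n < m) (hpn : p n ≤ c) (hqn : q n ≤ c)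
    (h : ∀ s, n < s → s ≤ m + 1 → p s = q s) :
    pathEdges k m p \ truncatedRegion k n c ⊆ pathEdges k m q := by
  rintro (⟨i, j⟩ | ⟨i, j⟩ | ⟨i, j⟩)
  · rintro ⟨⟨h1, h2, h3⟩, h4 : ¬ i ≤ n⟩
    exact ⟨h1, h2, h3.trans (h i (by omega) (by omega))⟩
  · rintro ⟨⟨h1, h2, h3⟩, h4 : ¬ (i ≤ n ∧ j ≤ truncate k n c (i + 1))⟩
    refine ⟨h1, h2, ?_⟩
    rcases lt_trichotomy i n with hi | rfl | hi
    · rw [truncate_of_le (show i + 1 ≤ n from hi)] at h4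
      have := hq.mono (show i + 1 ≤ n from hi) (by omega)
      omega
    · rw [truncate_of_ge (Nat.le_succ i)] at h4
      have := hp.le i (by omega)
      have := h (i + 1) (by omega) (by omega)
      omega
    · rwa [← h i hi (by omega), ← h (i + 1) (by omega) (by omega)]
  · rintro ⟨⟨h1, h2, h3⟩, h4 : ¬ (i ≤ n ∧ j ≤ truncate k n c (i + 1))⟩
    refine ⟨h1, ?_⟩
    rcases lt_trichotomy i n with hi | rfl | hi
    · rw [truncate_of_le (show i + 1 ≤ n from hi)] at h4
      have := hp.mono (show i + 1 ≤ n from hi) (by omega)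
      have := hp.le (i + 1) (by omega)
      omega
    · rw [truncate_of_ge (Nat.le_succ i)] at h4
      have := hq.le i (by omega)
      have := h (i + 1) (by omega) (by omega)
      omega
    · rw [← h i hi (by omega), ← h (i + 1) (by omega) (by omega)]
      exact ⟨h2, h3⟩

/-- The contribution of the matchings that contain `e`, if this amounts to prescribing the values
`t` of the path after row `n` and to bounding its value in row `n` by `c ≤ t (n + 1)`. Replacing
`t (n + 1)` by `v` gives a different matching with the same trace on the truncated region. -/
lemma finsum_mem_pathFamily {k t : ℕ → ℕ} {m n c v : ℕ} {e : LatticeEdge} (hk : Monotone k)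
    (hn : n < m) (he : ∀ p, IsPath k m p →
      (e ∈ pathEdges k m p ↔ p n ≤ c ∧ ∀ s, n < s → s ≤ m + 1 → p s = t s))
    (heR : e ∉ truncatedRegion k n c) (ht : ∀ s, n < s → s ≤ m → t s ≤ t (s + 1))
    (htk : ∀ s, n < s → s ≤ m + 1 → t s ≤ k s) (htm : t (m + 1) = k m)
    (hct : c ≤ t (n + 1)) (hcv : c ≤ v) (hvt : v ≠ t (n + 1)) (hvk : v ≤ k (n + 1))
    (hv : v ≤ t (n + 2)) :
    ∑ᶠ E ∈ {E ∈ pathFamily k m | e ∈ E}, (X : ℕ[X]) ^ familyForcingNumber (pathFamily k m) E =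
      familyPolynomial (pathFamily (truncate k n c) n) * X := by
  have hq : ∀ p : ℕ → ℕ, ∃ q : ℕ → ℕ, (∀ s ≤ n, q s = p s) ∧ q (n + 1) = min (k n) c :=
    fun p => ⟨fun s => if s ≤ n then p s else min (k n) c, fun s hs => if_pos hs,
      if_neg (by omega)⟩
  refine finsum_mem_familyForcingNumber heR ?_ ?_ ?_ ?_ fun H hH => exists_isFamilyForcingSet hH
  · rintro _ ⟨p, hp, rfl⟩ hep
    obtain ⟨hpn, hpt⟩ := (he p hp).1 hep
    obtain ⟨q, hq1, hq2⟩ := hq p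
    refine ⟨_, ⟨?_, ?_, ?_, ?_⟩, pathEdges_inter_truncatedRegion hk hp hn hpn
      (hct.trans_eq (hpt _ (by omega) (by omega)).symm) hq1 hq2⟩
    · rw [hq1 0 (by omega), hp.zero]
    · rw [hq2, truncate_of_le le_rfl]
    · intro s hs
      rcases hs.lt_or_eq with hs' | rfl
      · rw [hq1 s hs, hq1 (s + 1) hs']
        exact hp.step s (by omega)
      · rw [hq1 s hs, hq2]
        exact le_min (hp.le s (by omega)) hpn
    · intro s hs
      rcases le_or_gt s n with hs' | hs'
      · rw [hq1 s hs', truncate_of_le hs']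
        exact le_min (hp.le s (by omega)) ((hp.mono hs' (by omega)).trans hpn)
      · obtain rfl : s = n + 1 := by omega
        rw [hq2, truncate_of_ge (by omega)]
  · rintro _ ⟨q, hq, rfl⟩
    have hqn : q n ≤ min (k n) c := (hq.le n (by omega)).trans_eq (truncate_of_le le_rfl)
    set p : ℕ → ℕ := fun s => if s ≤ n then q s else t s with hpdef
    have hp1 : ∀ s ≤ n, p s = q s := fun s hs => if_pos hs
    have hp2 : ∀ s, n < s → p s = t s := fun s hs => if_neg (by omega)
    have hp : IsPath k m p := by
      refine ⟨?_, ?_, ?_, ?_⟩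
      · rw [hp1 0 (by omega), hq.zero]
      · rw [hp2 _ (by omega), htm]
      · intro s hs
        rcases lt_trichotomy s n with h | rfl | h
        · rw [hp1 s h.le, hp1 (s + 1) h]
          exact hq.step s h.le
        · rw [hp1 s le_rfl, hp2 (s + 1) (by omega)]
          exact (hqn.trans (min_le_right _ _)).trans hct
        · rw [hp2 s h, hp2 (s + 1) (by omega)]
          exact ht s h hs
      · intro s hs
        rcases le_or_gt s n with h | h
        · rw [hp1 s h]
          exact ((hq.le s (by omega)).trans_eq (truncate_of_le h)).trans (min_le_left _ _)
        · rw [hp2 s h]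
          exact htk s h hs
    have hpn : p n ≤ c := (hp1 n le_rfl).trans_le (hqn.trans (min_le_right _ _))
    refine ⟨_, ⟨p, hp, rfl⟩, (he p hp).2 ⟨hpn, fun s hs _ => hp2 s hs⟩, ?_⟩
    refine pathEdges_inter_truncatedRegion hk hp hn hpn (hct.trans_eq (hp2 _ (by omega)).symm)
      (fun s hs => (hp1 s hs).symm) ?_
    rw [hq.last, truncate_of_le le_rfl]
  · rintro _ ⟨p, hp, rfl⟩ hep _ ⟨q, hq, rfl⟩ heq
    obtain ⟨hpn, hpt⟩ := (he p hp).1 hep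
    obtain ⟨hqn, hqt⟩ := (he q hq).1 heq
    exact pathEdges_diff_truncatedRegion_subset hp hq hn hpn hqn
      fun s h1 h2 => (hpt s h1 h2).trans (hqt s h1 h2).symm
  · rintro _ ⟨p, hp, rfl⟩ hep
    obtain ⟨hpn, hpt⟩ := (he p hp).1 hep
    obtain ⟨q, hq1, hq2⟩ := hq p
    have hu1 : ∀ s, s ≠ n + 1 → Function.update p (n + 1) v s = p s :=
      fun s hs => Function.update_of_ne hs _ _
    have hu2 : Function.update p (n + 1) v (n + 1) = v := Function.update_self _ _ _
    set p' := Function.update p (n + 1) v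
    have hp' : IsPath k m p' := by
      refine ⟨?_, ?_, ?_, ?_⟩
      · rw [hu1 0 (by omega), hp.zero]
      · rw [hu1 _ (by omega), hp.last]
      · intro s hs
        rcases eq_or_ne s n with rfl | h
        · rw [hu1 s (by omega), hu2]
          exact hpn.trans hcv
        · rcases eq_or_ne s (n + 1) with rfl | h'
          · rw [hu2, hu1 _ (by omega), hpt _ (by omega) (by omega)]
            exact hv
          · rw [hu1 s h', hu1 (s + 1) (by omega)]
            exact hp.step s hs
      · intro s hs
        rcases eq_or_ne s (n + 1) with rfl | h'
        · rwa [hu2]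
        · rw [hu1 s h']
          exact hp.le s hs
    refine ⟨_, ⟨p', hp', rfl⟩, fun heq => hvt ?_, ?_⟩
    · have : LatticeEdge.vert (n + 1) v ∈ pathEdges k m p' := ⟨by omega, hn, hu2.symm⟩
      rw [heq] at this
      rw [this.2.2, hpt _ (by omega) (by omega)]
    · rw [pathEdges_inter_truncatedRegion hk hp hn hpn
        (hct.trans_eq (hpt _ (by omega) (by omega)).symm) hq1 hq2,
        ← pathEdges_inter_truncatedRegion hk hp' hn ((hu1 n (by omega)).trans_le hpn)
        (hcv.trans_eq hu2.symm) (fun s hs => (hq1 s hs).trans (hu1 s (by omega)).symm) hq2]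
      exact Set.inter_subset_left

lemma familyPolynomial_pathFamily {k : ℕ → ℕ} {m : ℕ} (hk0 : k 0 = 0) (hk : Monotone k)
    (hkm : k (m + 1) = k m) (hpos : 0 < k m) (hfin : (pathFamily k m).Finite) :
    familyPolynomial (pathFamily k m) =
      ∑ i ∈ Finset.range (k m),
        familyPolynomial (pathFamily (truncate k (m - 1) i) (m - 1)) * X +
      ∑ j ∈ Finset.Icc (sInf {s | 1 ≤ s ∧ s ≤ m ∧ k s = k m}) m,
        familyPolynomial (pathFamily (truncate k (j - 1) (k m - 1)) (j - 1)) * X := by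
  classical
  obtain ⟨n, rfl⟩ : ∃ n, m = n + 1 := Nat.exists_eq_succ_of_ne_zero (by rintro rfl; omega)
  set m := n + 1 with hm
  set j₀ := sInf {s | 1 ≤ s ∧ s ≤ m ∧ k s = k m} with hj₀
  obtain ⟨hj1, hj2, hj3⟩ : 1 ≤ j₀ ∧ j₀ ≤ m ∧ k j₀ = k m :=
    Nat.sInf_mem (s := {s | 1 ≤ s ∧ s ≤ m ∧ k s = k m}) ⟨m, by omega, le_rfl, rfl⟩
  have hmin : ∀ s, 1 ≤ s → s ≤ m → k s = k m → j₀ ≤ s :=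
    fun s h1 h2 h3 => Nat.sInf_le ⟨h1, h2, h3⟩
  set w : Set LatticeEdge → ℕ[X] := fun E => X ^ familyForcingNumber (pathFamily k m) E
  have hsum : ∀ e, ∑ᶠ E ∈ {E ∈ pathFamily k m | e ∈ E}, w E =
      ∑ E ∈ hfin.toFinset, if e ∈ E then w E else 0 := by
    intro e
    rw [← Finset.sum_filter, ← finsum_mem_finset_eq_sum]
    refine finsum_mem_congr ?_ fun _ _ => rfl
    ext E
    simp
  have hfirst : ∀ i ∈ Finset.range (k m),
      familyPolynomial (pathFamily (truncate k (m - 1) i) (m - 1)) * X =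
        ∑ E ∈ hfin.toFinset, if LatticeEdge.vert m i ∈ E then w E else 0 := by
    intro i hi
    rw [Finset.mem_range] at hi
    rw [← hsum, show m - 1 = n from rfl]
    refine (finsum_mem_pathFamily (t := fun s => if s = m then i else k m) (v := i + 1)
      hk (by omega) (fun p hp => ?_) (fun h => ?_) ?_ ?_ ?_ ?_ ?_ ?_ ?_ ?_).symm
    · rw [vert_mem_pathEdges]
      constructor
      · rintro ⟨-, -, rfl⟩
        refine ⟨hp.step n (by omega), fun s h1 h2 => ?_⟩
        split_ifs with h
        · rw [h]
        · rw [show s = m + 1 by omega, hp.last]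
      · rintro ⟨-, h⟩
        exact ⟨by omega, le_rfl, by simpa using (h m (by omega) (by omega)).symm⟩
    · have : m ≤ n := h
      omega
    · intro s h1 h2
      rw [if_pos (by omega), if_neg (by omega)]
      exact hi.le
    · intro s h1 h2
      rcases eq_or_ne s m with rfl | h
      · simpa using hi.le
      · rw [if_neg h, show s = m + 1 by omega, hkm]
    · simp
    · simp [hm]
    · omega
    · simp [hm]
    · exact hi
    · rw [if_neg (by omega)]
      exact hi
  have hsecond : ∀ j ∈ Finset.Icc j₀ m,
      familyPolynomial (pathFamily (truncate k (j - 1) (k m - 1)) (j - 1)) * X =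
        ∑ E ∈ hfin.toFinset, if LatticeEdge.downRight (j - 1) (k m) ∈ E then w E else 0 := by
    intro j hj
    rw [Finset.mem_Icc] at hj
    obtain ⟨j, rfl⟩ : ∃ r, j = r + 1 := Nat.exists_eq_succ_of_ne_zero (by omega)
    rw [← hsum, Nat.add_sub_cancel]
    have hkj : ∀ s, j < s → s ≤ m + 1 → k s = k m := fun s h1 h2 =>
      le_antisymm ((hk h2).trans_eq hkm) (hj3.symm.trans_le (hk (by omega)))
    refine (finsum_mem_pathFamily (t := fun _ => k m) (v := k m - 1)
      hk (by omega) (fun p hp => ?_) (fun h => ?_) ?_ ?_ ?_ ?_ ?_ ?_ ?_ ?_).symm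
    · rw [downRight_mem_pathEdges]
      constructor
      · rintro ⟨h1, h2, h3⟩
        refine ⟨by omega, fun s h4 h5 => ?_⟩
        exact le_antisymm ((hp.le s h5).trans_eq (hkj s h4 h5)) (h3.trans (hp.mono h4 h5))
      · rintro ⟨h1, h2⟩
        exact ⟨by omega, by omega, (h2 _ (by omega) (by omega)).ge⟩
    · obtain ⟨-, h⟩ : j ≤ j ∧ k m ≤ truncate k j (k m - 1) (j + 1) := h
      rw [truncate_of_ge (by omega)] at h
      omega
    · exact fun _ _ _ => le_rfl
    · exact fun s h1 h2 => (hkj s h1 h2).ge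
    · rfl
    · exact Nat.sub_le _ _
    · rfl
    · omega
    · rw [hkj (j + 1) (by omega) (by omega)]
      omega
    · omega
  rw [Finset.sum_congr rfl hfirst, Finset.sum_congr rfl hsecond, Finset.sum_comm,
    Finset.sum_comm (s := Finset.Icc j₀ m), ← Finset.sum_add_distrib, familyPolynomial,
    finsum_mem_eq_finite_toFinset_sum _ hfin]
  refine Finset.sum_congr rfl fun E hE => ?_
  obtain ⟨p, hp, rfl⟩ := hfin.mem_toFinset.1 hE
  change w _ = _
  have hpm : p m ≤ k m := hp.le m (by omega)
  rcases hpm.lt_or_eq with hlt | heq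
  · rw [Finset.sum_eq_single_of_mem (p m) (Finset.mem_range.2 hlt), if_pos ⟨by omega, le_rfl, rfl⟩,
      Finset.sum_eq_zero, add_zero]
    · intro j hj
      rw [Finset.mem_Icc] at hj
      refine if_neg fun h => ?_
      have h1 := (downRight_mem_pathEdges.1 h).2.2
      have h2 := hp.mono (show j - 1 + 1 ≤ m by omega) (by omega)
      omega
    · exact fun i _ hi => if_neg fun h => hi h.2.2
  · -- The relevant edge is at the first row in which the path attains its maximal value `k m`.
    have hex : ∃ s, p s = k m := ⟨m, heq⟩
    set j := Nat.find hex
    have hpj : p j = k m := Nat.find_spec hex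
    have hjm : j ≤ m := Nat.find_min' hex heq
    have hj0 : j ≠ 0 := fun h => by
      have := hp.zero
      rw [h] at hpj
      omega
    have hkj : k j = k m :=
      le_antisymm (hk hjm) (hpj.symm.trans_le (hp.le j (by omega)))
    rw [Finset.sum_eq_zero, zero_add, Finset.sum_eq_single_of_mem j, if_pos]
    · refine ⟨by omega, ?_, ?_⟩
      · refine lt_of_le_of_ne ?_ (Nat.find_min hex (show j - 1 < j by omega))
        exact (hp.mono (show j - 1 ≤ m by omega) (by omega)).trans_eq heq
      · rw [Nat.sub_add_cancel (by omega), hpj]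
    · exact Finset.mem_Icc.2 ⟨hmin j (by omega) hjm hkj, hjm⟩
    · intro i hi hij
      rw [Finset.mem_Icc] at hi
      refine if_neg fun h => hij ?_
      obtain ⟨h1, h2, h3⟩ := downRight_mem_pathEdges.1 h
      rw [Nat.sub_add_cancel (by omega)] at h3
      have h4 : p i = k m := le_antisymm ((hp.mono hi.2 (by omega)).trans_eq heq) h3
      refine le_antisymm ?_ (Nat.find_min' hex h4)
      by_contra! hlt
      have := hp.mono (show j ≤ i - 1 by omega) (by omega)
      omega
    · intro i hi
      rw [Finset.mem_range] at hi
      refine if_neg fun h => ?_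
      have := h.2.2
      omega

/-! ### Perfect matchings as sets of named edges -/

/-- Exactly one of three propositions holds. -/
def ExactlyOne (P Q R : Prop) : Prop :=
  (P ∨ Q ∨ R) ∧ ¬ (P ∧ Q) ∧ ¬ (P ∧ R) ∧ ¬ (Q ∧ R)

lemma ExactlyOne.first_iff {P Q R : Prop} (h : ExactlyOne P Q R) : P ↔ ¬ Q ∧ ¬ R := by
  unfold ExactlyOne at h
  tauto

lemma ExactlyOne.second_iff {P Q R : Prop} (h : ExactlyOne P Q R) : Q ↔ ¬ P ∧ ¬ R := by
  unfold ExactlyOne at h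
  tauto

lemma ExactlyOne.third_iff {P Q R : Prop} (h : ExactlyOne P Q R) : R ↔ ¬ P ∧ ¬ Q := by
  unfold ExactlyOne at h
  tauto

/-- The edges of the hexagonal system with rows of lengths `k 1, …, k m`, when `1 ≤ m`,
`1 ≤ k 1`, `k` is weakly increasing and `k (m + 1) = k m`. -/
def edgeRegion (k : ℕ → ℕ) (m : ℕ) : Set LatticeEdge :=
  {a | match a with
    | .vert i j => 1 ≤ i ∧ i ≤ m ∧ j ≤ k i
    | .downLeft i j => i ≤ m ∧ j ≤ k (i + 1) ∧ ¬ (i = 0 ∧ j = 0) ∧ ¬ (i = m ∧ j = k m)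
    | .downRight i j => i ≤ m ∧ 1 ≤ j ∧ j ≤ k (i + 1)}

/-- `T` is (the edge set of) a perfect matching: it consists of edges of the hexagonal system, and
exactly one of the three lattice edges at each of its vertices `lower i j` and `upper (i + 1) j`
belongs to `T`. -/
structure IsMatchingSet (k : ℕ → ℕ) (m : ℕ) (T : Set LatticeEdge) : Prop where
  subset : T ⊆ edgeRegion k m
  lower : ∀ i j, i ≤ m → j ≤ k (i + 1) → ¬ (i = 0 ∧ j = 0) →
    ExactlyOne (.vert i j ∈ T) (.downLeft i j ∈ T) (.downRight i j ∈ T)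
  upper : ∀ i j, i ≤ m → j ≤ k (i + 1) → ¬ (i = m ∧ j = k m) →
    ExactlyOne (.vert (i + 1) j ∈ T) (.downLeft i j ∈ T) (.downRight i (j + 1) ∈ T)

lemma IsPath.isMatchingSet {k p : ℕ → ℕ} {m : ℕ} (hp : IsPath k m p) :
    IsMatchingSet k m (pathEdges k m p) := by
  refine ⟨?_, ?_, ?_⟩
  · rintro (⟨i, j⟩ | ⟨i, j⟩ | ⟨i, j⟩)
    · rintro ⟨h1, h2, rfl⟩
      exact ⟨h1, h2, hp.le i (by omega)⟩
    · rintro ⟨h1, h2, h3⟩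
      refine ⟨h1, h2, ?_, ?_⟩
      · rintro ⟨rfl, rfl⟩
        have := hp.zero
        omega
      · rintro ⟨rfl, rfl⟩
        have := hp.last
        have := hp.step i le_rfl
        omega
    · rintro ⟨h1, h2, h3⟩
      exact ⟨h1, by omega, h3.trans (hp.le _ (by omega))⟩
  · intro i j hi hj h0
    simp only [ExactlyOne, vert_mem_pathEdges, downLeft_mem_pathEdges, downRight_mem_pathEdges]
    have := hp.step i hi
    rcases Nat.eq_zero_or_pos i with rfl | h
    · have := hp.zero
      omega
    · omega
  · intro i j hi hj h0
    simp only [ExactlyOne, vert_mem_pathEdges, downLeft_mem_pathEdges, downRight_mem_pathEdges]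
    have := hp.step i hi
    rcases hi.lt_or_eq with h | rfl
    · omega
    · have := hp.last
      omega

/-- A zigzag from which one lower vertex `q` and some upper vertices are removed has a perfect
matching only if a single upper vertex `r ≥ q` is removed, and then the matching is determined. Here
`a j` and `b j` state that the edges from the lower vertex `j` to the upper vertices `j` and `j - 1`
are in the matching, while `v j` and `w j` state that the lower, respectively upper, vertex `j`
is removed. -/
lemma exists_of_zigzag {v w a b : ℕ → Prop} {q K : ℕ} (hq : q ≤ K)
    (hv : ∀ j ≤ K, v j ↔ j = q) (h1 : ∀ j ≤ K, ExactlyOne (v j) (a j) (b j))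
    (h2 : ∀ j ≤ K, ExactlyOne (w j) (a j) (b (j + 1))) (hb0 : ¬ b 0) (hbK : ¬ b (K + 1)) :
    ∃ r, q ≤ r ∧ r ≤ K ∧
      ∀ j ≤ K, (w j ↔ j = r) ∧ (a j ↔ j < q ∨ r < j) ∧ (b j ↔ q < j ∧ j ≤ r) := by
  classical
  have ha : ∀ j ≤ K, (a j ↔ j ≠ q ∧ ¬ b j) := fun j hj => by
    rw [(h1 j hj).second_iff, hv j hj]
  have hb : ∀ j ≤ K, (b (j + 1) ↔ ¬ w j ∧ (j = q ∨ b j)) := fun j hj => by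
    rw [(h2 j hj).third_iff, ha j hj, not_and_not_right, or_iff_not_imp_left]
  have hbq : ∀ j ≤ q, ¬ b j := by
    intro j
    induction j with
    | zero => exact fun _ => hb0
    | succ j ih =>
      intro hj h
      rcases ((hb j (by omega)).1 h).2 with h' | h'
      · omega
      · exact ih (by omega) h'
  have hex : ∃ r, q ≤ r ∧ r ≤ K ∧ w r := by
    by_contra! hw
    have hbs : ∀ j, q ≤ j → j ≤ K → b (j + 1) := by
      intro j hj
      induction j, hj using Nat.le_induction with
      | base => exact fun hK => (hb q hK).2 ⟨hw q le_rfl hK, Or.inl rfl⟩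
      | succ j hj ih =>
        exact fun hK => (hb (j + 1) hK).2 ⟨hw (j + 1) (by omega) hK, Or.inr (ih (by omega))⟩
    exact hbK (hbs K hq le_rfl)
  obtain ⟨hqr, hrK, hwr⟩ := Nat.find_spec hex
  have hlt : ∀ j, q ≤ j → j < Nat.find hex → ¬ w j := fun j h3 h4 h5 =>
    Nat.find_min hex h4 ⟨h3, by omega, h5⟩
  set r := Nat.find hex
  have hbs : ∀ j, q ≤ j → j < r → b (j + 1) := by
    intro j hj
    induction j, hj using Nat.le_induction with
    | base => exact fun hr => (hb q hq).2 ⟨hlt q le_rfl hr, Or.inl rfl⟩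
    | succ j hj ih =>
      exact fun hr => (hb (j + 1) (by omega)).2 ⟨hlt (j + 1) (by omega) hr, Or.inr (ih (by omega))⟩
  have hbr : ∀ j, r ≤ j → j ≤ K → ¬ b (j + 1) := by
    intro j hj
    induction j, hj using Nat.le_induction with
    | base => exact fun hK h => ((hb r hK).1 h).1 hwr
    | succ j hj ih =>
      intro hK h
      rcases ((hb (j + 1) hK).1 h).2 with h' | h'
      · omega
      · exact ih (by omega) h'
  have hb1 : ∀ j ≤ K, (b (j + 1) ↔ q ≤ j ∧ j < r) := fun j hj =>
    ⟨fun h => ⟨by by_contra! h3; exact hbq _ h3 h, by by_contra! h3; exact hbr j h3 hj h⟩,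
      fun h => hbs j h.1 h.2⟩
  have hbj : ∀ j ≤ K, (b j ↔ q < j ∧ j ≤ r) := by
    rintro (_ | j) hj
    · exact ⟨fun h => absurd h hb0, fun h => absurd h.1 (by omega)⟩
    · rw [hb1 j (by omega)]
      omega
  have haj : ∀ j ≤ K, (a j ↔ j < q ∨ r < j) := fun j hj => by
    rw [ha j hj, hbj j hj]
    omega
  refine ⟨r, hqr, hrK, fun j hj => ⟨?_, haj j hj, hbj j hj⟩⟩
  rw [(h2 j hj).first_iff, haj j hj, hb1 j hj]
  omega

/-- Row by row, the zigzags force every perfect matching to be the one of a path. -/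
lemma IsMatchingSet.exists_isPath {k : ℕ → ℕ} {m : ℕ} {T : Set LatticeEdge} (hk0 : k 0 = 0)
    (hk : Monotone k) (hkm : k (m + 1) = k m) (hT : IsMatchingSet k m T) :
    ∃ p, IsPath k m p ∧ T = pathEdges k m p := by
  -- The values `p 0 = 0` and `p (m + 1) = k m` correspond to fictitious vertical edges.
  set W : ℕ → ℕ → Prop := fun i j => .vert i j ∈ T ∨ (i = 0 ∧ j = 0) ∨ (i = m + 1 ∧ j = k m)
    with hW
  have hWle : ∀ i j, W i j → j ≤ k i := by
    rintro i j (h | ⟨rfl, rfl⟩ | ⟨rfl, rfl⟩)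
    · exact (hT.subset h).2.2
    · exact Nat.zero_le _
    · exact hkm.ge
  have hlower : ∀ i j, i ≤ m → j ≤ k (i + 1) →
      ExactlyOne (W i j) (.downLeft i j ∈ T) (.downRight i j ∈ T) := by
    intro i j hi hj
    by_cases h : i = 0 ∧ j = 0
    · obtain ⟨rfl, rfl⟩ := h
      have h1 : LatticeEdge.downLeft 0 0 ∉ T := fun h => (hT.subset h).2.2.1 ⟨rfl, rfl⟩
      have h2 : LatticeEdge.downRight 0 0 ∉ T := fun h => absurd (hT.subset h).2.1 (by simp)
      simp [ExactlyOne, hW, h1, h2]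
    · have h1 : W i j ↔ .vert i j ∈ T := or_iff_left (by omega)
      rw [h1]
      exact hT.lower i j hi hj h
  have hupper : ∀ i j, i ≤ m → j ≤ k (i + 1) →
      ExactlyOne (W (i + 1) j) (.downLeft i j ∈ T) (.downRight i (j + 1) ∈ T) := by
    intro i j hi hj
    by_cases h : i = m ∧ j = k m
    · obtain ⟨rfl, rfl⟩ := h
      have h1 : LatticeEdge.downLeft i (k i) ∉ T := fun h => (hT.subset h).2.2.2 ⟨rfl, rfl⟩
      have h2 : LatticeEdge.downRight i (k i + 1) ∉ T :=
        fun h => absurd (hT.subset h).2.2 (by omega)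
      simp [ExactlyOne, hW, h1, h2]
    · have h1 : W (i + 1) j ↔ .vert (i + 1) j ∈ T := or_iff_left (by omega)
      rw [h1]
      exact hT.upper i j hi hj h
  have hzigzag : ∀ i ≤ m, ∀ q ≤ k i, (∀ j, W i j ↔ j = q) → ∃ r, q ≤ r ∧ r ≤ k (i + 1) ∧
      ∀ j ≤ k (i + 1), (W (i + 1) j ↔ j = r) ∧ (.downLeft i j ∈ T ↔ j < q ∨ r < j) ∧
        (.downRight i j ∈ T ↔ q < j ∧ j ≤ r) := by
    intro i hi q hq hqW
    refine exists_of_zigzag (v := W i) (hq.trans (hk (Nat.le_succ i))) (fun j _ => hqW j)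
      (fun j hj => hlower i j hi hj) (fun j hj => hupper i j hi hj)
      (fun h => absurd (hT.subset h).2.1 (by simp))
      (fun h => absurd (hT.subset h).2.2 (by simp))
  have hrow : ∀ i, ∃ q, i ≤ m + 1 → q ≤ k i ∧ ∀ j, W i j ↔ j = q := by
    intro i
    induction i with
    | zero =>
      refine ⟨0, fun _ => ⟨Nat.zero_le _,
        fun j => ⟨fun h => ?_, fun h => Or.inr (Or.inl ⟨rfl, h⟩)⟩⟩⟩
      have := hWle 0 j h
      omega
    | succ i ih =>
      obtain ⟨q, hq⟩ := ih
      by_cases hi : i ≤ m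
      · obtain ⟨hq1, hq2⟩ := hq (by omega)
        obtain ⟨r, -, hr, hrW⟩ := hzigzag i hi q hq1 hq2
        exact ⟨r, fun _ => ⟨hr, fun j => ⟨fun h => (hrW j (hWle _ j h)).1.1 h,
          fun h => (hrW j (h.trans_le hr)).1.2 h⟩⟩⟩
      · exact ⟨0, fun h => absurd h (by omega)⟩
  choose p hp using hrow
  have hpz : ∀ i ≤ m, p i ≤ p (i + 1) ∧ ∀ j ≤ k (i + 1),
      (.downLeft i j ∈ T ↔ j < p i ∨ p (i + 1) < j) ∧
        (.downRight i j ∈ T ↔ p i < j ∧ j ≤ p (i + 1)) := by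
    intro i hi
    obtain ⟨r, hr1, hr2, hr3⟩ := hzigzag i hi (p i) (hp i (by omega)).1 (hp i (by omega)).2
    have hr : r = p (i + 1) := ((hp (i + 1) (by omega)).2 r).1 ((hr3 r hr2).1.2 rfl)
    subst hr
    exact ⟨hr1, fun j hj => (hr3 j hj).2⟩
  have hpath : IsPath k m p := by
    refine ⟨?_, ?_, fun s hs => (hpz s hs).1, fun s hs => (hp s hs).1⟩
    · exact (((hp 0 (by omega)).2 0).1 (Or.inr (Or.inl ⟨rfl, rfl⟩))).symm
    · exact (((hp (m + 1) le_rfl).2 (k m)).1 (Or.inr (Or.inr ⟨rfl, rfl⟩))).symm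
  refine ⟨p, hpath, ?_⟩
  ext (⟨i, j⟩ | ⟨i, j⟩ | ⟨i, j⟩)
  · rw [vert_mem_pathEdges]
    constructor
    · intro h
      obtain ⟨h1, h2, -⟩ := hT.subset h
      exact ⟨h1, h2, ((hp i (by omega)).2 j).1 (Or.inl h)⟩
    · rintro ⟨h1, h2, h3⟩
      exact (((hp i (by omega)).2 j).2 h3).resolve_right (by omega)
  · rw [downLeft_mem_pathEdges]
    constructor
    · intro h
      obtain ⟨h1, h2, -⟩ := hT.subset h
      exact ⟨h1, h2, ((hpz i h1).2 j h2).1.1 h⟩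
    · rintro ⟨h1, h2, h3⟩
      exact ((hpz i h1).2 j h2).1.2 h3
  · rw [downRight_mem_pathEdges]
    constructor
    · intro h
      obtain ⟨h1, -, h2⟩ := hT.subset h
      exact ⟨h1, ((hpz i h1).2 j h2).2.1 h⟩
    · rintro ⟨h1, h2⟩
      exact ((hpz i h1).2 j (h2.2.trans (hpath.le _ (by omega)))).2.2 h2

lemma setOf_isMatchingSet {k : ℕ → ℕ} {m : ℕ} (hk0 : k 0 = 0) (hk : Monotone k)
    (hkm : k (m + 1) = k m) : {T | IsMatchingSet k m T} = pathFamily k m := by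
  ext T
  constructor
  · exact fun h => h.exists_isPath hk0 hk hkm
  · rintro ⟨p, hp, rfl⟩
    exact hp.isMatchingSet

/-! ### The hexagonal lattice -/

/-- The edge of the hexagonal lattice that is named by a `LatticeEdge`. -/
def LatticeEdge.toSym2 : LatticeEdge → Sym2 HexVertex
  | .vert i j => s(.upper i j, .lower i j)
  | .downLeft i j => s(.lower i j, .upper (i + 1) j)
  | .downRight i j => s(.lower i j, .upper (i + 1) (j - 1))

lemma LatticeEdge.toSym2_injective : Function.Injective LatticeEdge.toSym2 := by
  rintro (⟨i, j⟩ | ⟨i, j⟩ | ⟨i, j⟩) (⟨i', j'⟩ | ⟨i', j'⟩ | ⟨i', j'⟩) h <;>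
    simp [toSym2] at h ⊢ <;> omega

lemma corner_ne (c : ℤ × ℤ) (t : Fin 6) : corner c t ≠ corner c (t + 1) := by
  fin_cases t <;> simp [corner]

lemma mk_mem_image_toSym2_lower {T : Set LatticeEdge} {i j : ℕ} {y : HexVertex} :
    s(.lower i j, y) ∈ LatticeEdge.toSym2 '' T ↔
      (.vert i j ∈ T ∧ y = .upper i j) ∨ (.downLeft i j ∈ T ∧ y = .upper (i + 1) j) ∨
        (.downRight i j ∈ T ∧ y = .upper (i + 1) (j - 1)) := by
  constructor
  · rintro ⟨⟨i', j'⟩ | ⟨i', j'⟩ | ⟨i', j'⟩, ha, h⟩ <;>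
      simp only [LatticeEdge.toSym2, Sym2.eq_iff, HexVertex.lower.injEq, reduceCtorEq, false_and,
        and_false, false_or, or_false, Nat.cast_inj] at h <;> obtain ⟨h1, h2⟩ := h
    · obtain ⟨rfl, rfl⟩ := h2
      exact Or.inl ⟨ha, h1.symm⟩
    · obtain ⟨rfl, rfl⟩ := h1
      exact Or.inr (Or.inl ⟨ha, h2.symm⟩)
    · obtain ⟨rfl, rfl⟩ := h1
      exact Or.inr (Or.inr ⟨ha, h2.symm⟩)
  · rintro (⟨h, rfl⟩ | ⟨h, rfl⟩ | ⟨h, rfl⟩)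
    · exact ⟨_, h, Sym2.eq_swap⟩
    · exact ⟨_, h, rfl⟩
    · exact ⟨_, h, rfl⟩

lemma mk_mem_image_toSym2_upper {T : Set LatticeEdge} {i j : ℕ} {y : HexVertex} :
    s(.upper (i + 1) j, y) ∈ LatticeEdge.toSym2 '' T ↔
      (.vert (i + 1) j ∈ T ∧ y = .lower (i + 1) j) ∨ (.downLeft i j ∈ T ∧ y = .lower i j) ∨
        (.downRight i (j + 1) ∈ T ∧ y = .lower i (j + 1)) := by
  constructor
  · rintro ⟨⟨i', j'⟩ | ⟨i', j'⟩ | ⟨i', j'⟩, ha, h⟩ <;>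
      simp only [LatticeEdge.toSym2, Sym2.eq_iff, HexVertex.upper.injEq, reduceCtorEq, false_and,
        and_false, false_or, or_false] at h <;> obtain ⟨h1, h2⟩ := h
    · obtain ⟨rfl, rfl⟩ : i' = i + 1 ∧ j' = j := by omega
      exact Or.inl ⟨ha, by rw [← h2]; push_cast; rfl⟩
    · obtain ⟨rfl, rfl⟩ : i' = i ∧ j' = j := by omega
      exact Or.inr (Or.inl ⟨ha, h1.symm⟩)
    · obtain ⟨rfl, rfl⟩ : i' = i ∧ j' = j + 1 := by omega
      exact Or.inr (Or.inr ⟨ha, by rw [← h1]; push_cast; rfl⟩)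
  · rintro (⟨h, rfl⟩ | ⟨h, rfl⟩ | ⟨h, rfl⟩)
    · exact ⟨_, h, by simp [LatticeEdge.toSym2]⟩
    · exact ⟨_, h, Sym2.eq_swap⟩
    · exact ⟨_, h, by simp [LatticeEdge.toSym2]⟩

lemma existsUnique_iff_exactlyOne {α : Type*} {P Q R : Prop} {x y z : α} (hxy : x ≠ y)
    (hxz : x ≠ z) (hyz : y ≠ z) :
    (∃! t, (P ∧ t = x) ∨ (Q ∧ t = y) ∨ (R ∧ t = z)) ↔ ExactlyOne P Q R := by
  constructor
  · rintro ⟨t, ht, hu⟩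
    refine ⟨by tauto, ?_, ?_, ?_⟩
    · rintro ⟨hP, hQ⟩
      exact hxy ((hu x (by tauto)).trans (hu y (by tauto)).symm)
    · rintro ⟨hP, hR⟩
      exact hxz ((hu x (by tauto)).trans (hu z (by tauto)).symm)
    · rintro ⟨hQ, hR⟩
      exact hyz ((hu y (by tauto)).trans (hu z (by tauto)).symm)
  · rintro ⟨hP | hQ | hR, h1, h2, h3⟩
    · exact ⟨x, by tauto, by intro t; tauto⟩
    · exact ⟨y, by tauto, by intro t; tauto⟩
    · exact ⟨z, by tauto, by intro t; tauto⟩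

section Region

variable {k : ℕ → ℕ} {m : ℕ}

lemma mem_chsCells {c : ℤ × ℤ} : c ∈ chsCells k (fun _ => 1) m ↔
    ∃ i j : ℕ, 1 ≤ i ∧ i ≤ m ∧ 1 ≤ j ∧ j ≤ k i ∧ c = ((i : ℤ), (j : ℤ)) := by
  simp only [chsCells, Finset.mem_biUnion, Finset.mem_image, Finset.mem_Icc]
  constructor
  · rintro ⟨i, ⟨h1, h2⟩, j, ⟨h3, h4⟩, rfl⟩
    exact ⟨i, j, h1, h2, h3, h4, rfl⟩
  · rintro ⟨i, j, h1, h2, h3, h4, rfl⟩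
    exact ⟨i, ⟨h1, h2⟩, j, ⟨h3, h4⟩, rfl⟩

lemma hexEdges_chsCells (hk : Monotone k) (hkm : k (m + 1) = k m) (hk1 : 1 ≤ k 1)
    (hm : 1 ≤ m) :
    hexEdges (chsCells k (fun _ => 1) m) = LatticeEdge.toSym2 '' edgeRegion k m := by
  ext e
  constructor
  · rintro ⟨c, hc, t, rfl⟩
    obtain ⟨i, j, hi, him, hj, hjk, rfl⟩ := mem_chsCells.1 hc
    obtain ⟨i, rfl⟩ : ∃ i', i = i' + 1 := Nat.exists_eq_succ_of_ne_zero (by omega)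
    obtain ⟨j, rfl⟩ : ∃ j', j = j' + 1 := Nat.exists_eq_succ_of_ne_zero (by omega)
    have hki := hk (show i + 1 ≤ i + 1 + 1 by omega)
    have hkm' := hk him
    fin_cases t
    · refine ⟨.downLeft i (j + 1), ⟨by omega, hjk, by omega, by omega⟩, ?_⟩
      simp [LatticeEdge.toSym2, corner]
    · refine ⟨.vert (i + 1) (j + 1), ⟨by omega, him, hjk⟩, ?_⟩
      simp [LatticeEdge.toSym2, corner]
    · refine ⟨.downRight (i + 1) (j + 1), ⟨him, by omega, by omega⟩, ?_⟩
      simp [LatticeEdge.toSym2, corner]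
    · refine ⟨.downLeft (i + 1) j, ⟨him, by omega, by omega, by omega⟩, ?_⟩
      simp [LatticeEdge.toSym2, corner]
    · refine ⟨.vert (i + 1) j, ⟨by omega, him, by omega⟩, ?_⟩
      simp [LatticeEdge.toSym2, corner]
    · refine ⟨.downRight i (j + 1), ⟨by omega, by omega, hjk⟩, ?_⟩
      simp [LatticeEdge.toSym2, corner]
  · rintro ⟨⟨i, j⟩ | ⟨i, j⟩ | ⟨i, j⟩, ha, rfl⟩
    · obtain ⟨h1, h2, h3⟩ : 1 ≤ i ∧ i ≤ m ∧ j ≤ k i := ha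
      have hki := hk h1
      rcases Nat.eq_zero_or_pos j with rfl | hj
      · exact ⟨_, mem_chsCells.2 ⟨i, 1, h1, h2, le_rfl, by omega, rfl⟩, 4,
          by simp [LatticeEdge.toSym2, corner]⟩
      · exact ⟨_, mem_chsCells.2 ⟨i, j, h1, h2, hj, h3, rfl⟩, 1,
          by simp [LatticeEdge.toSym2, corner]⟩
    · obtain ⟨h1, h2, h3, h4⟩ : i ≤ m ∧ j ≤ k (i + 1) ∧ ¬ (i = 0 ∧ j = 0) ∧
        ¬ (i = m ∧ j = k m) := ha
      by_cases h : 1 ≤ i ∧ j + 1 ≤ k i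
      · exact ⟨_, mem_chsCells.2 ⟨i, j + 1, h.1, h1, by omega, h.2, rfl⟩, 3,
          by simp [LatticeEdge.toSym2, corner]⟩
      · have him : i ≠ m := by
          rintro rfl
          omega
        have hj : 1 ≤ j := by
          rcases Nat.eq_zero_or_pos i with rfl | hi
          · omega
          · have := hk hi
            simp only [Nat.succ_eq_add_one, Nat.zero_add] at this
            omega
        exact ⟨_, mem_chsCells.2 ⟨i + 1, j, by omega, by omega, hj, h2, rfl⟩, 0,
          by simp [LatticeEdge.toSym2, corner]⟩
    · obtain ⟨h1, h2, h3⟩ : i ≤ m ∧ 1 ≤ j ∧ j ≤ k (i + 1) := ha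
      by_cases h : 1 ≤ i ∧ j ≤ k i
      · exact ⟨_, mem_chsCells.2 ⟨i, j, h.1, h1, h2, h.2, rfl⟩, 2,
          by simp [LatticeEdge.toSym2, corner]⟩
      · have him : i ≠ m := by
          rintro rfl
          omega
        exact ⟨_, mem_chsCells.2 ⟨i + 1, j, by omega, by omega, h2, h3, rfl⟩, 5,
          by simp [LatticeEdge.toSym2, corner]⟩

lemma mem_hexVertices_chsCells (hk : Monotone k) (hkm : k (m + 1) = k m) (hk1 : 1 ≤ k 1)
    (hm : 1 ≤ m) {x : HexVertex} : x ∈ hexVertices (chsCells k (fun _ => 1) m) ↔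
      (∃ i j : ℕ, i ≤ m ∧ j ≤ k (i + 1) ∧ ¬ (i = 0 ∧ j = 0) ∧ x = .lower i j) ∨
        ∃ i j : ℕ, i ≤ m ∧ j ≤ k (i + 1) ∧ ¬ (i = m ∧ j = k m) ∧ x = .upper (i + 1) j := by
  constructor
  · rintro ⟨c, hc, t, rfl⟩
    obtain ⟨i, j, hi, him, hj, hjk, rfl⟩ := mem_chsCells.1 hc
    obtain ⟨i, rfl⟩ : ∃ i', i = i' + 1 := Nat.exists_eq_succ_of_ne_zero (by omega)
    obtain ⟨j, rfl⟩ : ∃ j', j = j' + 1 := Nat.exists_eq_succ_of_ne_zero (by omega)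
    have hki := hk (show i + 1 ≤ i + 1 + 1 by omega)
    have hkm' := hk him
    fin_cases t
    · exact Or.inl ⟨i, j + 1, by omega, hjk, by omega, by simp [corner]⟩
    · exact Or.inr ⟨i, j + 1, by omega, hjk, by omega, by simp [corner]⟩
    · exact Or.inl ⟨i + 1, j + 1, him, by omega, by omega, by simp [corner]⟩
    · exact Or.inr ⟨i + 1, j, him, by omega, by omega, by simp [corner]⟩
    · exact Or.inl ⟨i + 1, j, him, by omega, by omega, by simp [corner]⟩
    · exact Or.inr ⟨i, j, by omega, by omega, by omega, by simp [corner]⟩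
  · rintro (⟨i, j, h1, h2, h3, rfl⟩ | ⟨i, j, h1, h2, h3, rfl⟩)
    · by_cases h : 1 ≤ i ∧ j ≤ k i
      · have hki := hk h.1
        rcases Nat.eq_zero_or_pos j with rfl | hj
        · exact ⟨_, mem_chsCells.2 ⟨i, 1, h.1, h1, le_rfl, by omega, rfl⟩, 4, by simp [corner]⟩
        · exact ⟨_, mem_chsCells.2 ⟨i, j, h.1, h1, hj, h.2, rfl⟩, 2, by simp [corner]⟩
      · have him : i ≠ m := by
          rintro rfl
          omega
        exact ⟨_, mem_chsCells.2 ⟨i + 1, j, by omega, by omega, by omega, h2, rfl⟩, 0,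
          by simp [corner]⟩
    · have hki := hk (show 1 ≤ i + 1 by omega)
      rcases h1.lt_or_eq with him | rfl
      · rcases Nat.eq_zero_or_pos j with rfl | hj
        · exact ⟨_, mem_chsCells.2 ⟨i + 1, 1, by omega, him, le_rfl, by omega, rfl⟩, 5,
            by simp [corner]⟩
        · exact ⟨_, mem_chsCells.2 ⟨i + 1, j, by omega, him, hj, h2, rfl⟩, 1, by simp [corner]⟩
      · exact ⟨_, mem_chsCells.2 ⟨i, j + 1, hm, le_rfl, by omega, by omega, rfl⟩, 3,
          by simp [corner]⟩

lemma setOf_perfectMatching_chsCells (hk : Monotone k) (hkm : k (m + 1) = k m) (hk1 : 1 ≤ k 1)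
    (hm : 1 ≤ m) :
    {E | E ⊆ hexEdges (chsCells k (fun _ => 1) m) ∧
      ∀ x ∈ hexVertices (chsCells k (fun _ => 1) m), ∃! y, s(x, y) ∈ E} =
        Set.image LatticeEdge.toSym2 '' {T | IsMatchingSet k m T} := by
  have hlower : ∀ (T : Set LatticeEdge) (i j : ℕ),
      (∃! y, s(.lower i j, y) ∈ LatticeEdge.toSym2 '' T) ↔
        ExactlyOne (.vert i j ∈ T) (.downLeft i j ∈ T) (.downRight i j ∈ T) := by
    intro T i j
    simp only [mk_mem_image_toSym2_lower]
    exact existsUnique_iff_exactlyOne (by simp) (by simp) (by simp; omega)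
  have hupper : ∀ (T : Set LatticeEdge) (i j : ℕ),
      (∃! y, s(.upper (i + 1) j, y) ∈ LatticeEdge.toSym2 '' T) ↔
        ExactlyOne (.vert (i + 1) j ∈ T) (.downLeft i j ∈ T) (.downRight i (j + 1) ∈ T) := by
    intro T i j
    simp only [mk_mem_image_toSym2_upper]
    exact existsUnique_iff_exactlyOne (by simp) (by simp) (by simp)
  rw [hexEdges_chsCells hk hkm hk1 hm]
  ext E
  constructor
  · rintro ⟨hE, hu⟩
    obtain ⟨T, hT, rfl⟩ := Set.subset_image_iff.1 hE
    exact ⟨T, ⟨hT,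
      fun i j h1 h2 h3 => (hlower T i j).1 (hu _ ((mem_hexVertices_chsCells hk hkm hk1 hm).2
        (Or.inl ⟨i, j, h1, h2, h3, rfl⟩))),
      fun i j h1 h2 h3 => (hupper T i j).1 (hu _ ((mem_hexVertices_chsCells hk hkm hk1 hm).2
        (Or.inr ⟨i, j, h1, h2, h3, rfl⟩)))⟩, rfl⟩
  · rintro ⟨T, hT : IsMatchingSet k m T, rfl⟩
    refine ⟨Set.image_mono hT.subset, fun x hx => ?_⟩
    rcases (mem_hexVertices_chsCells hk hkm hk1 hm).1 hx with
      ⟨i, j, h1, h2, h3, rfl⟩ | ⟨i, j, h1, h2, h3, rfl⟩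
    · exact (hlower T i j).2 (hT.lower i j h1 h2 h3)
    · exact (hupper T i j).2 (hT.upper i j h1 h2 h3)

end Region

/-! ### Perfect matchings of hexagonal graphs -/

lemma edgeSet_injOn_isPerfectMatching {V : Type*} (G : SimpleGraph V) :
    Set.InjOn (fun M : G.Subgraph => M.edgeSet) {M | M.IsPerfectMatching} := by
  intro M hM M' hM' h
  refine SimpleGraph.Subgraph.ext ?_ ?_
  · rw [hM.2.verts_eq_univ, hM'.2.verts_eq_univ]
  · ext a b
    rw [← SimpleGraph.Subgraph.mem_edgeSet, ← SimpleGraph.Subgraph.mem_edgeSet]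
    exact Set.ext_iff.1 h s(a, b)

lemma forcingPolynomial_eq_familyPolynomial {V : Type*} [Finite V] (G : SimpleGraph V) :
    forcingPolynomial G =
      familyPolynomial ((fun M : G.Subgraph => M.edgeSet) '' {M | M.IsPerfectMatching}) := by
  rw [forcingPolynomial, familyPolynomial, finsum_mem_image (edgeSet_injOn_isPerfectMatching G),
    finsum_mem_eq_finite_toFinset_sum _ (Set.toFinite _)]
  refine Finset.sum_congr rfl fun M hM => ?_
  have hM' : M.IsPerfectMatching := by simpa using hM
  congr 1
  unfold forcingNumber familyForcingNumber
  congr 1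
  ext n
  refine exists_congr fun S => and_congr_left fun _ => and_congr_right fun _ => ?_
  constructor
  · rintro h _ ⟨M', hM', rfl⟩ hS
    exact congrArg _ (h M' hM' hS)
  · exact fun h M'' hM'' hS =>
      edgeSet_injOn_isPerfectMatching G hM'' hM' (h _ ⟨M'', hM'', rfl⟩ hS)

lemma image_edgeSet_isPerfectMatching (S : Finset (ℤ × ℤ)) :
    Set.image (Sym2.map Subtype.val) ''
      ((fun M : (hexGraph S).Subgraph => M.edgeSet) '' {M | M.IsPerfectMatching}) =
        {E | E ⊆ hexEdges S ∧ ∀ x ∈ hexVertices S, ∃! y, s(x, y) ∈ E} := by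
  ext E
  constructor
  · rintro ⟨_, ⟨M, hM, rfl⟩, rfl⟩
    refine ⟨?_, fun x hx => ?_⟩
    · rintro _ ⟨e, he, rfl⟩
      induction e with
      | _ a b =>
        exact ((SimpleGraph.fromEdgeSet_adj _).1 (M.adj_sub he)).1
    · obtain ⟨y, hy, hu⟩ := SimpleGraph.Subgraph.isPerfectMatching_iff.1 hM ⟨x, hx⟩
      refine ⟨y, ⟨s(⟨x, hx⟩, y), hy, rfl⟩, ?_⟩
      rintro z ⟨e, he, hez⟩
      induction e with
      | _ a b =>
        rw [Sym2.map_mk, Sym2.eq_iff] at hez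
        rcases hez with ⟨rfl, rfl⟩ | ⟨rfl, rfl⟩
        · exact congrArg Subtype.val (hu b he)
        · exact congrArg Subtype.val (hu a (M.adj_symm he))
  · rintro ⟨hE, hu⟩
    have hmem : ∀ {a b}, s(a, b) ∈ E → a ∈ hexVertices S ∧ b ∈ hexVertices S ∧ a ≠ b := by
      intro a b hab
      obtain ⟨c, hc, t, h⟩ := hE hab
      have hne := corner_ne c t
      rcases Sym2.eq_iff.1 h with ⟨rfl, rfl⟩ | ⟨rfl, rfl⟩
      · exact ⟨⟨c, hc, t, rfl⟩, ⟨c, hc, t + 1, rfl⟩, hne⟩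
      · exact ⟨⟨c, hc, t + 1, rfl⟩, ⟨c, hc, t, rfl⟩, hne.symm⟩
    let M : (hexGraph S).Subgraph :=
      { verts := Set.univ
        Adj := fun a b => s(a.1, b.1) ∈ E
        adj_sub := fun {a b} h => (SimpleGraph.fromEdgeSet_adj _).2 ⟨hE h, (hmem h).2.2⟩
        edge_vert := fun _ => Set.mem_univ _
        symm := ⟨fun a b h => by rwa [Sym2.eq_swap]⟩ }
    refine ⟨_, ⟨M, SimpleGraph.Subgraph.isPerfectMatching_iff.2 ?_, rfl⟩, ?_⟩
    · rintro ⟨x, hx⟩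
      obtain ⟨y, hy, hyu⟩ := hu x hx
      exact ⟨⟨y, (hmem hy).2.1⟩, hy, fun z hz => Subtype.ext (hyu z.1 hz)⟩
    · ext e
      constructor
      · rintro ⟨e, he, rfl⟩
        induction e with
        | _ a b => exact he
      · intro he
        induction e with
        | _ a b => exact ⟨s(⟨a, (hmem he).1⟩, ⟨b, (hmem he).2.1⟩), he, rfl⟩

lemma forcingPolynomial_hexGraph (S : Finset (ℤ × ℤ)) :
    forcingPolynomial (hexGraph S) =
      familyPolynomial {E | E ⊆ hexEdges S ∧ ∀ x ∈ hexVertices S, ∃! y, s(x, y) ∈ E} := by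
  rw [forcingPolynomial_eq_familyPolynomial, ← image_edgeSet_isPerfectMatching,
    familyPolynomial_image (Sym2.map.injective Subtype.val_injective)]

lemma forcingPolynomial_hexGraph_empty : forcingPolynomial (hexGraph ∅) = 1 := by
  rw [forcingPolynomial_hexGraph, ← familyPolynomial_singleton (∅ : Set (Sym2 HexVertex))]
  congr 1
  ext E
  simp [hexEdges, hexVertices]

/-! ### Forcing polynomials of truncated parallelograms -/

section PathModel

variable {k : ℕ → ℕ} {m : ℕ}

lemma F_congr_chsCells {k' : ℕ → ℕ} {m' : ℕ}
    (h : chsCells k (fun _ => 1) m = chsCells k' (fun _ => 1) m') : F k m = F k' m' :=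
  congrArg (fun S => forcingPolynomial (hexGraph S)) h

lemma F_congr {k' : ℕ → ℕ} (h : ∀ s, 1 ≤ s → s ≤ m → k s = k' s) : F k m = F k' m := by
  refine F_congr_chsCells (Finset.biUnion_congr rfl fun s hs => ?_)
  rw [Finset.mem_Icc] at hs
  simp only [h s hs.1 hs.2]

lemma image_pathFamily (hk0 : k 0 = 0) (hk : Monotone k) (hkm : k (m + 1) = k m)
    (hk1 : 1 ≤ k 1) (hm : 1 ≤ m) :
    Set.image LatticeEdge.toSym2 '' pathFamily k m =
      Set.image (Sym2.map Subtype.val) ''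
        ((fun M : (CHS k (fun _ => 1) m).Subgraph => M.edgeSet) '' {M | M.IsPerfectMatching}) := by
  rw [← setOf_isMatchingSet hk0 hk hkm, ← setOf_perfectMatching_chsCells hk hkm hk1 hm,
    ← image_edgeSet_isPerfectMatching, CHS]

lemma finite_pathFamily (hk0 : k 0 = 0) (hk : Monotone k) (hkm : k (m + 1) = k m)
    (hk1 : 1 ≤ k 1) (hm : 1 ≤ m) : (pathFamily k m).Finite := by
  refine Set.Finite.of_finite_image (f := Set.image LatticeEdge.toSym2) ?_
    LatticeEdge.toSym2_injective.image_injective.injOn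
  rw [image_pathFamily hk0 hk hkm hk1 hm]
  exact ((Set.toFinite _).image _).image _

/-- In the degenerate case `k m = 0` the graph is empty and `0` is the only path. -/
lemma F_eq_familyPolynomial (hk0 : k 0 = 0) (hk : Monotone k) (hkm : k (m + 1) = k m)
    (hk1 : k m = 0 ∨ 1 ≤ k 1) : F k m = familyPolynomial (pathFamily k m) := by
  by_cases h : k m = 0
  · have hcells : chsCells k (fun _ => 1) m = ∅ := by
      refine Finset.eq_empty_of_forall_notMem fun c hc => ?_
      obtain ⟨i, j, -, h2, h3, h4, -⟩ := mem_chsCells.1 hc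
      have := hk h2
      omega
    have hfam : pathFamily k m = {pathEdges k m 0} := by
      have hk' : ∀ s ≤ m + 1, k s = 0 := fun s hs => by
        have := hk hs
        omega
      ext E
      constructor
      · rintro ⟨p, hp, rfl⟩
        refine pathEdges_congr fun s hs => ?_
        exact Nat.le_zero.1 ((hp.le s hs).trans_eq (hk' s hs))
      · rintro rfl
        exact ⟨0, ⟨rfl, h.symm, fun _ _ => le_rfl, fun _ _ => Nat.zero_le _⟩, rfl⟩
    rw [hfam, familyPolynomial_singleton, ← forcingPolynomial_hexGraph_empty]
    exact congrArg (fun S => forcingPolynomial (hexGraph S)) hcells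
  · have hm : 1 ≤ m := by
      by_contra! hm
      obtain rfl : m = 0 := by omega
      exact h hk0
    rw [F, forcingPolynomial_eq_familyPolynomial,
      ← familyPolynomial_image (Sym2.map.injective Subtype.val_injective),
      ← image_pathFamily hk0 hk hkm (hk1.resolve_left h) hm,
      familyPolynomial_image LatticeEdge.toSym2_injective]

lemma F_min_eq_familyPolynomial (hk0 : k 0 = 0) (hk : Monotone k) (hk1 : 1 ≤ k 1) (n c : ℕ) :
    F (fun s => min (k s) c) n = familyPolynomial (pathFamily (truncate k n c) n) := by
  rw [← F_eq_familyPolynomial]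
  · exact F_congr fun s _ hs => (truncate_of_le hs).symm
  · rw [truncate_of_le (Nat.zero_le n), hk0, Nat.zero_min]
  · exact fun s t hst => min_le_min_right c (hk (min_le_min_right n hst))
  · rw [truncate_of_ge (Nat.le_succ n), truncate_of_le le_rfl]
  · rcases Nat.eq_zero_or_pos n with rfl | hn
    · rw [truncate_of_le le_rfl, hk0, Nat.zero_min]
      exact Or.inl rfl
    · rw [truncate_of_le le_rfl, truncate_of_le (show 1 ≤ n from hn)]
      omega

lemma F_recursion (hk0 : k 0 = 0) (hk : Monotone k) (hkm : k (m + 1) = k m) (hk1 : 1 ≤ k 1)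
    (hm : 1 ≤ m) :
    F k m = (∑ i ∈ Finset.range (k m), F (fun s => min (k s) i) (m - 1) * X) +
      ∑ j ∈ Finset.Icc (sInf {s | 1 ≤ s ∧ s ≤ m ∧ k s = k m}) m,
        F (fun s => min (k s) (k m - 1)) (j - 1) * X := by
  have hpos : 0 < k m := hk1.trans (hk hm)
  rw [F_eq_familyPolynomial hk0 hk hkm (Or.inr hk1),
    familyPolynomial_pathFamily hk0 hk hkm hpos (finite_pathFamily hk0 hk hkm hk1 hm)]
  simp only [F_min_eq_familyPolynomial hk0 hk hk1]

end PathModel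

end Forcing
end

theorem corollary3p3 :
    (∀ (m : ℕ) (k : ℕ → ℕ), 1 ≤ m → 1 ≤ k 1 →
      (∀ s, 1 ≤ s → s < m → k s ≤ k (s + 1)) →
      Forcing.F k m =
        (∑ i ∈ Finset.range (k m),
          Forcing.F (fun s => min (k s) i) (m - 1) * Polynomial.X) +
        (∑ j ∈ Finset.Icc (sInf {s | 1 ≤ s ∧ s ≤ m ∧ k s = k m}) m,
          Forcing.F (fun s => min (k s) (k m - 1)) (j - 1) * Polynomial.X)) ∧
    (∀ (b : ℕ → ℕ) (i : ℕ), 1 ≤ i → b i = 0 → Forcing.F b i = Forcing.F b (i - 1)) ∧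
    (∀ b : ℕ → ℕ, Forcing.F b 0 = 1) := by
  refine ⟨fun m k hm hk1 hk => ?_, fun b i hi hb => ?_, fun b => ?_⟩
  · -- Only `k 1, …, k m` matter, so `k` may be taken to be `0` at `0` and constant from `m` on.
    obtain ⟨k', h0, h1, h2⟩ : ∃ k' : ℕ → ℕ, k' 0 = 0 ∧
        (∀ s, 1 ≤ s → s ≤ m → k' s = k s) ∧ ∀ s, m ≤ s → k' s = k m :=
      ⟨fun s => if s = 0 then 0 else if s ≤ m then k s else k m, if_pos rfl,
        fun s hs hs' => by
          beta_reduce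
          rw [if_neg (by omega), if_pos hs'],
        fun s hs => by
          beta_reduce
          rw [if_neg (by omega)]
          split_ifs with h
          · rw [le_antisymm h hs]
          · rfl⟩
    have hmono : Monotone k' := by
      refine monotone_nat_of_le_succ fun s => ?_
      rcases Nat.eq_zero_or_pos s with rfl | hs
      · rw [h0]
        exact Nat.zero_le _
      · rcases lt_or_ge s m with hsm | hsm
        · rw [h1 s hs hsm.le, h1 (s + 1) (by omega) hsm]
          exact hk s hs hsm
        · rw [h2 s hsm, h2 (s + 1) (by omega)]
    have hset : {s | 1 ≤ s ∧ s ≤ m ∧ k' s = k' m} = {s | 1 ≤ s ∧ s ≤ m ∧ k s = k m} := by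
      ext s
      refine and_congr_right fun hs => and_congr_right fun hs' => ?_
      rw [h1 s hs hs', h2 m le_rfl]
    have hmin : ∀ n ≤ m, ∀ c,
        Forcing.F (fun s => min (k' s) c) n = Forcing.F (fun s => min (k s) c) n :=
      fun n hn c => Forcing.F_congr fun s hs hs' => by rw [h1 s hs (hs'.trans hn)]
    rw [← Forcing.F_congr h1, Forcing.F_recursion h0 hmono (by rw [h2 m le_rfl, h2 _ (by omega)])
      ((h1 1 le_rfl hm).symm ▸ hk1) hm, hset, h2 m le_rfl]
    congr 1
    · exact Finset.sum_congr rfl fun i _ => by rw [hmin _ (by omega)]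
    · refine Finset.sum_congr rfl fun j hj => ?_
      rw [Finset.mem_Icc] at hj
      rw [hmin _ (by omega)]
  · refine Forcing.F_congr_chsCells ?_
    ext c
    rw [Forcing.mem_chsCells, Forcing.mem_chsCells]
    constructor
    · rintro ⟨s, j, h1, h2, h3, h4, rfl⟩
      refine ⟨s, j, h1, ?_, h3, h4, rfl⟩
      rcases h2.lt_or_eq with h | rfl <;> omega
    · rintro ⟨s, j, h1, h2, h⟩
      exact ⟨s, j, h1, by omega, h⟩
  · rw [← Forcing.forcingPolynomial_hexGraph_empty]
    exact congrArg (fun S => Forcing.forcingPolynomial (Forcing.hexGraph S)) rfl
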